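/- **Conventions.** A graph has vertices, arcs, an origin map $o$, a terminus map $t$ and an arc reversal $a\mapsto\bar a$ with $\bar{\bar a}=a$ and $o(a)=t(\bar a)$; arcs with $\bar a=a$ (self-reverse) are allowed. A tree is a connected graph without loops, multiple arcs or cycles. Permutation groups act on non-empty sets. A *graph of group actions* $\mathcal G$ consists of a connected base graph $\Delta$; permutation groups $G(v)\le \mathrm{Sym}(X(v))$ for the vertices $v$ and $H(a)\le\mathrm{Sym}(Y(a))$ for the arcs $a$ of $\Delta$, with $(H(\bar a),Y(\bar a))=(H(a),Y(a))$; for every arc $a$ an injection $\Phi_a:Y(a)\to X(t(a))$ which identifies $H(a)$ with the permutation group induced on $\Phi_a(Y(a))$ by its setwise stabiliser in $G(t(a))$; and for every self-reverse arc $a$ a permutation $h_a$ of $Y(a)$ with $h_aH(a)h_a^{-1}=H(a)$ and $h_a^2\in H(a)$. An *$a$-adhesion map* is a map $\gamma\Phi_a$ with $\gamma\in G(t(a))$, an *$a$-adhesion set* is the image of one, and, for $a$ self-reverse, a *twisted $a$-adhesion map* is a map $\gamma\Phi_ah_a$ with $\gamma\in G(t(a))$. Let $\Sigma$ be a graph with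 an equivalence relation $\sim$ on its vertices; call two arcs equivalent if their origins are equivalent and their termini are equivalent. Let $T=\Sigma/\!\sim$ be the quotient graph, and write $[x]$ for the class of a vertex or arc $x$ of $\Sigma$ as a subset of $\Sigma$ and $\llbracket x\rrbracket$ for the same class as a vertex or arc of $T$. Let $\pi:T\to\Delta$ be a graph morphism. A *legal colouring* of $\Sigma$ is a map $p$ on the vertices and arcs of $\Sigma$ such that 1. $p$ restricts to bijections $p_{\llbracket v\rrbracket}:[v]\to X(\pi(\llbracket v\rrbracket))$ and $[a]\to Y(\pi(\llbracket a\rrbracket))$ for all vertices $v$ and arcs $a$ of $\Sigma$, and $p(\bar a)=p(a)$ for every arc $a$; 2. for every arc $a$ of $\Sigma$, let $\Psi_{\llbracket a\rrbracket}:Y(\pi(\llbracket a\rrbracket))\to X(\pi(t(\llbracket a\rrbracket)))$ be the map with $\Psi_{\llbracket a\rrbracket}(p(b))=p(t(b))$ for all $b\in[a]$. If $\pi(\llbracket a\rrbracket)$ is not self-reverse, $\Psi_{\llbracket a\rrbracket}$ is a $\pi(\llbracket a\rrbracket)$-adhesion map. If $\pi(\llbracket a\rrbracket)$ is self-reverse,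 one of $\Psi_{\llbracket a\rrbracket},\Psi_{\llbracket\bar a\rrbracket}$ is a $\pi(\llbracket a\rrbracket)$-adhesion map and the other is a twisted one; 3. for every vertex $\llbracket v\rrbracket$ of $T$, every arc $b$ of $\Delta$ with $t(b)=\pi(\llbracket v\rrbracket)$ and every $b$-adhesion set $B$ there is exactly one arc $\llbracket a\rrbracket$ of $T$ with $\pi(\llbracket a\rrbracket)=b$, $t(\llbracket a\rrbracket)=\llbracket v\rrbracket$ and $\Psi_{\llbracket a\rrbracket}(p([a]))=B$. $(\Sigma,\sim,\pi)$ is a *scaffolding* for $\mathcal G$ if $T$ is a tree, no arc of $\Sigma$ joins two equivalent vertices, and a legal colouring exists. $\mathrm{Aut}_{\mathrm{sc}}(\Sigma)$ is the group of automorphisms of the graph $\Sigma$ that preserve $\sim$ and satisfy $\pi(\llbracket g(x)\rrbracket)=\pi(\llbracket x\rrbracket)$ for all vertices and arcs $x$. The *local action* of $g\in\mathrm{Aut}_{\mathrm{sc}}(\Sigma)$ at $\llbracket v\rrbracket$ with respect to $p$ is the permutation $g_{\llbracket v\rrbracket}=p\,g\,p_{\llbracket v\rrbracket}^{-1}$ of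 $X(\pi(\llbracket v\rrbracket))$. The *universal group* $\mathcal U(\mathcal G)$ with respect to $p$ is the group of all $g\in\mathrm{Aut}_{\mathrm{sc}}(\Sigma)$ with $g_{\llbracket v\rrbracket}\in G(\pi(\llbracket v\rrbracket))$ for all vertices $\llbracket v\rrbracket$ of $T$. A subgroup $H\le\mathrm{Aut}_{\mathrm{sc}}(\Sigma)$ is *locally-$\mathcal G$* if there is a legal colouring $p'$ of $\Sigma$ such that for every $h\in H$ and every vertex $\llbracket v\rrbracket$ of $T$ the local action of $h$ at $\llbracket v\rrbracket$ with respect to $p'$ is in $G(\pi(\llbracket v\rrbracket))$. **Theorem (universality).** Let $\mathcal G$ be a graph of group actions, let $\Sigma$ be a scaffolding for $\mathcal G$, and let $\mathcal U(\mathcal G)$ be the universal group defined with respect to $\Sigma$ and some legal colouring $p$. Then every locally-$\mathcal G$ subgroup of $\mathrm{Aut}_{\mathrm{sc}}(\Sigma)$ is conjugate in $\mathrm{Aut}_{\mathrm{sc}}(\Sigma)$ to a subgroup of $\mathcal U(\mathcal G)$. -/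

import Mathlib

/-! ### Graphs in the sense of Serre -/

/-- A graph with vertices `V` and arcs `A`: every arc has an origin, a terminus and a reverse.
Self-reverse arcs (necessarily loops) and multiple arcs are allowed. -/
structure SerreGraph (V : Type*) (A : Type*) where
  o : A → V
  t : A → V
  rev : A → A
  rev_rev : ∀ a, rev (rev a) = a
  o_eq : ∀ a, o a = t (rev a)

namespace SerreGraph

variable {V A V' A' : Type*}

theorem t_eq (Γ : SerreGraph V A) (a : A) : Γ.t a = Γ.o (Γ.rev a) := by
  rw [Γ.o_eq, Γ.rev_rev]

/-- The underlying simple graph: distinct vertices joined by an arc are adjacent. -/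
def toSimpleGraph (Γ : SerreGraph V A) : SimpleGraph V where
  Adj u v := u ≠ v ∧ ∃ a, Γ.o a = u ∧ Γ.t a = v
  symm := ⟨by
    rintro u v ⟨h, a, rfl, rfl⟩
    exact ⟨h.symm, Γ.rev a, (Γ.t_eq a).symm, (Γ.o_eq a).symm⟩⟩
  loopless := ⟨fun _ h => h.1 rfl⟩

/-- A graph is connected if any two vertices are joined by a path (and it has a vertex). -/
def IsConnected (Γ : SerreGraph V A) : Prop := Γ.toSimpleGraph.Connected

/-- A graph is simple if it has no loops and an arc is determined by its origin and terminus. -/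
structure IsSimple (Γ : SerreGraph V A) : Prop where
  no_loops : ∀ a, Γ.o a ≠ Γ.t a
  injective : Function.Injective fun a => (Γ.o a, Γ.t a)

/-- A tree is a simple connected graph without cycles. -/
def IsTree (Γ : SerreGraph V A) : Prop := Γ.IsSimple ∧ Γ.toSimpleGraph.IsTree

/-- Morphisms of graphs. -/
structure Hom (Γ : SerreGraph V A) (Γ' : SerreGraph V' A') where
  onV : V → V'
  onA : A → A'
  map_o : ∀ a, onV (Γ.o a) = Γ'.o (onA a)
  map_t : ∀ a, onV (Γ.t a) = Γ'.t (onA a)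
  map_rev : ∀ a, onA (Γ.rev a) = Γ'.rev (onA a)

/-- The automorphism group of a graph; an automorphism is a pair consisting of a permutation of
the vertices and a permutation of the arcs. -/
def aut (Γ : SerreGraph V A) : Subgroup (Equiv.Perm V × Equiv.Perm A) where
  carrier := {g | (∀ a, g.1 (Γ.o a) = Γ.o (g.2 a)) ∧ (∀ a, g.1 (Γ.t a) = Γ.t (g.2 a)) ∧
    ∀ a, g.2 (Γ.rev a) = Γ.rev (g.2 a)}
  one_mem' := by simp
  mul_mem' := by
    rintro g h ⟨g1, g2, g3⟩ ⟨h1, h2, h3⟩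
    refine ⟨fun a => ?_, fun a => ?_, fun a => ?_⟩ <;> simp [h1, h2, h3, g1, g2, g3]
  inv_mem' := by
    rintro g ⟨g1, g2, g3⟩
    refine ⟨fun a => ?_, fun a => ?_, fun a => ?_⟩
    · exact (Equiv.symm_apply_eq _).2 (by simp [g1])
    · exact (Equiv.symm_apply_eq _).2 (by simp [g2])
    · exact (Equiv.symm_apply_eq _).2 (by simp [g3])

/-- The extension of an equivalence relation on vertices to the arcs: two arcs are equivalent if
their origins are equivalent and their termini are equivalent. -/
def arcSetoid (Γ : SerreGraph V A) (r : Setoid V) : Setoid A where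
  r a b := r (Γ.o a) (Γ.o b) ∧ r (Γ.t a) (Γ.t b)
  iseqv :=
    ⟨fun _ => ⟨r.refl _, r.refl _⟩, fun h => ⟨r.symm h.1, r.symm h.2⟩,
      fun h k => ⟨r.trans h.1 k.1, r.trans h.2 k.2⟩⟩

/-- The quotient graph of `Γ` by an equivalence relation on the vertices, extended to the arcs. -/
def quotient (Γ : SerreGraph V A) (r : Setoid V) :
    SerreGraph (Quotient r) (Quotient (Γ.arcSetoid r)) where
  o := Quotient.map Γ.o fun _ _ h => h.1
  t := Quotient.map Γ.t fun _ _ h => h.2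
  rev := Quotient.map Γ.rev fun a b h => by
    refine ⟨?_, ?_⟩
    · rw [← Γ.t_eq, ← Γ.t_eq]; exact h.2
    · rw [← Γ.o_eq, ← Γ.o_eq]; exact h.1
  rev_rev := by
    rintro ⟨a⟩
    exact congrArg (Quotient.mk (Γ.arcSetoid r)) (Γ.rev_rev a)
  o_eq := by
    rintro ⟨a⟩
    exact congrArg (Quotient.mk r) (Γ.o_eq a)

end SerreGraph

/-! ### Graphs of group actions -/

/-- A graph of group actions. The sets `X v` acted on at the vertices are subsets of an ambient
type `α`, the sets `Y a` acted on at the arcs are subsets of an ambient type `β`, and permutation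
groups on these sets are subgroups of the symmetric groups. -/
structure GraphOfGroupActions (V A α β : Type*) where
  /-- the base graph -/
  Δ : SerreGraph V A
  connected : Δ.IsConnected
  /-- the action at a vertex -/
  X : V → Set α
  X_nonempty : ∀ v, (X v).Nonempty
  G : ∀ v, Subgroup (Equiv.Perm (X v))
  /-- the action at an arc -/
  Y : A → Set β
  Y_nonempty : ∀ a, (Y a).Nonempty
  H : ∀ a, Subgroup (Equiv.Perm (Y a))
  Y_rev : ∀ a, Y (Δ.rev a) = Y a
  H_rev : ∀ a, (H (Δ.rev a)).map (Equiv.setCongr (Y_rev a)).permCongrHom.toMonoidHom = H a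
  /-- the embedding of the action at `a` into the action at the terminus of `a`: it identifies
  `H a` with the permutation group induced on the image of `Φ a` by its setwise stabiliser -/
  Φ : ∀ a, Y a ↪ X (Δ.t a)
  Φ_embeds : ∀ a, ∀ h ∈ H a, ∃ g ∈ G (Δ.t a), ∀ y, g (Φ a y) = Φ a (h y)
  Φ_induced : ∀ a, ∀ g ∈ G (Δ.t a), g '' Set.range (Φ a) = Set.range (Φ a) →
    ∃ h ∈ H a, ∀ y, g (Φ a y) = Φ a (h y)
  /-- the inversion agent of a self-reverse arc -/
  agent : ∀ a, Δ.rev a = a → Equiv.Perm (Y a)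
  agent_conj : ∀ a ha, (H a).map (MulAut.conj (agent a ha)).toMonoidHom = H a
  agent_sq : ∀ a ha, agent a ha ^ 2 ∈ H a

namespace GraphOfGroupActions

variable {V A α β : Type*} (𝒢 : GraphOfGroupActions V A α β)

/-- An `a`-adhesion map is a map `γ Φ_a` with `γ ∈ G(t(a))`. -/
def IsAdhesionMap (a : A) (Ψ : 𝒢.Y a → 𝒢.X (𝒢.Δ.t a)) : Prop :=
  ∃ γ ∈ 𝒢.G (𝒢.Δ.t a), ∀ y, Ψ y = γ (𝒢.Φ a y)

/-- A twisted `a`-adhesion map, for `a` self-reverse, is a map `γ Φ_a h_a` with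
`γ ∈ G(t(a))` and `h_a` the inversion agent. -/
def IsTwistedAdhesionMap (a : A) (Ψ : 𝒢.Y a → 𝒢.X (𝒢.Δ.t a)) : Prop :=
  ∃ ha : 𝒢.Δ.rev a = a, ∃ γ ∈ 𝒢.G (𝒢.Δ.t a), ∀ y, Ψ y = γ (𝒢.Φ a (𝒢.agent a ha y))

/-- An `a`-adhesion set is a translate of the image of `Φ_a` under an element of `G(t(a))`;
it is a subset of `X(t(a))`, seen as a set in the ambient type. -/
def IsAdhesionSet (a : A) (S : Set α) : Prop :=
  ∃ γ ∈ 𝒢.G (𝒢.Δ.t a), S = Set.range fun y => (γ (𝒢.Φ a y) : α)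

end GraphOfGroupActions

/-! ### Scaffoldings -/

/-- A graph `Σ` with an equivalence relation on its vertices (extended to its arcs) and a graph
morphism `π` from the quotient graph to the base graph of `𝒢`. -/
structure ScaffoldingFrame {V A α β : Type*} (𝒢 : GraphOfGroupActions V A α β)
    (VS AS : Type*) where
  graph : SerreGraph VS AS
  rel : Setoid VS
  π : (graph.quotient rel).Hom 𝒢.Δ

namespace ScaffoldingFrame

variable {V A α β VS AS : Type*} {𝒢 : GraphOfGroupActions V A α β}

/-- The vertices of the quotient graph `T = Σ/∼`. -/
abbrev VT (S : ScaffoldingFrame 𝒢 VS AS) : Type _ := Quotient S.rel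

/-- The arcs of the quotient graph `T = Σ/∼`. -/
abbrev AT (S : ScaffoldingFrame 𝒢 VS AS) : Type _ := Quotient (S.graph.arcSetoid S.rel)

/-- The quotient graph `T = Σ/∼`. -/
abbrev T (S : ScaffoldingFrame 𝒢 VS AS) : SerreGraph S.VT S.AT := S.graph.quotient S.rel

/-- The vertex of `T` given by a vertex of `Σ`. -/
def vmk (S : ScaffoldingFrame 𝒢 VS AS) (v : VS) : S.VT := Quotient.mk _ v

/-- The arc of `T` given by an arc of `Σ`. -/
def amk (S : ScaffoldingFrame 𝒢 VS AS) (a : AS) : S.AT := Quotient.mk _ a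

/-- The vertex bundle of a vertex of `T`. -/
def vertexBundle (S : ScaffoldingFrame 𝒢 VS AS) (q : S.VT) : Set VS := {w | S.vmk w = q}

/-- The arc bundle of an arc of `T`. -/
def arcBundle (S : ScaffoldingFrame 𝒢 VS AS) (e : S.AT) : Set AS := {b | S.amk b = e}

/-- The group of scaffolding automorphisms: the automorphisms of the graph `Σ` which preserve
`∼` and leave `π` invariant. -/
def autSc (S : ScaffoldingFrame 𝒢 VS AS) : Subgroup (Equiv.Perm VS × Equiv.Perm AS) where
  carrier := {g | g ∈ S.graph.aut ∧ (∀ v w, S.rel v w ↔ S.rel (g.1 v) (g.1 w)) ∧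
    (∀ v, S.π.onV (S.vmk (g.1 v)) = S.π.onV (S.vmk v)) ∧
    ∀ a, S.π.onA (S.amk (g.2 a)) = S.π.onA (S.amk a)}
  one_mem' := ⟨one_mem _, by simp⟩
  mul_mem' := by
    rintro g h ⟨g0, g1, g2, g3⟩ ⟨h0, h1, h2, h3⟩
    refine ⟨mul_mem g0 h0, fun v w => ?_, fun v => ?_, fun a => ?_⟩
    · exact (h1 v w).trans (g1 _ _)
    · exact (g2 _).trans (h2 v)
    · exact (g3 _).trans (h3 a)
  inv_mem' := by
    rintro g ⟨g0, g1, g2, g3⟩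
    refine ⟨inv_mem g0, fun v w => ?_, fun v => ?_, fun a => ?_⟩
    · simpa using (g1 (g.1⁻¹ v) (g.1⁻¹ w)).symm
    · simpa using (g2 (g.1⁻¹ v)).symm
    · simpa using (g3 (g.2⁻¹ a)).symm

/-- The permutation of the vertices of `T` induced by a scaffolding automorphism. -/
def act (S : ScaffoldingFrame 𝒢 VS AS) (g : S.autSc) : S.VT → S.VT :=
  Quotient.map g.1.1 fun v w h => (g.2.2.1 v w).1 h

theorem act_eq_iff (S : ScaffoldingFrame 𝒢 VS AS) (g : S.autSc) (q : S.VT) (w : VS) :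
    S.vmk w = q ↔ S.vmk (g.1.1 w) = S.act g q := by
  induction q using Quotient.inductionOn with
  | h v => exact Quotient.eq.trans ((g.2.2.1 w v).trans Quotient.eq.symm)

theorem π_act (S : ScaffoldingFrame 𝒢 VS AS) (g : S.autSc) (q : S.VT) :
    S.π.onV (S.act g q) = S.π.onV q := by
  induction q using Quotient.inductionOn with
  | h v => exact g.2.2.2.1 v

end ScaffoldingFrame

/-- A map `p` on the vertices and arcs of `Σ` which restricts to bijections from the vertex
bundles onto the sets `X(π(v))` and from the arc bundles onto the sets `Y(π(a))` and takes the same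
value at an arc and at its reverse. -/
structure Colouring {V A α β VS AS : Type*} {𝒢 : GraphOfGroupActions V A α β}
    (S : ScaffoldingFrame 𝒢 VS AS) where
  onV : VS → α
  onA : AS → β
  bijOn_V : ∀ q : S.VT, Set.BijOn onV (S.vertexBundle q) (𝒢.X (S.π.onV q))
  bijOn_A : ∀ e : S.AT, Set.BijOn onA (S.arcBundle e) (𝒢.Y (S.π.onA e))
  map_rev : ∀ a, onA a = onA (S.graph.rev a)

namespace Colouring

variable {V A α β VS AS : Type*} {𝒢 : GraphOfGroupActions V A α β}
  {S : ScaffoldingFrame 𝒢 VS AS}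

/-- The bijection `p_v` from a vertex bundle `[v]` to `X(π(v))`. -/
noncomputable def equivV (p : Colouring S) (q : S.VT) :
    S.vertexBundle q ≃ 𝒢.X (S.π.onV q) := Set.BijOn.equiv p.onV (p.bijOn_V q)

/-- The bijection `p_a` from an arc bundle `[a]` to `Y(π(a))`. -/
noncomputable def equivA (p : Colouring S) (e : S.AT) :
    S.arcBundle e ≃ 𝒢.Y (S.π.onA e) := Set.BijOn.equiv p.onA (p.bijOn_A e)

theorem t_mem (p : Colouring S) {e : S.AT} {b : AS} (hb : b ∈ S.arcBundle e) :
    p.onV (S.graph.t b) ∈ 𝒢.X (𝒢.Δ.t (S.π.onA e)) := by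
  rw [← S.π.map_t]
  refine (p.bijOn_V _).mapsTo ?_
  cases hb
  rfl

/-- The unique map `Ψ_a` from `Y(π(a))` to `X(t(π(a)))` with `Ψ_a p(b) = p t(b)` for all
arcs `b` in the arc bundle `[a]`. -/
noncomputable def transition (p : Colouring S) (e : S.AT) :
    𝒢.Y (S.π.onA e) → 𝒢.X (𝒢.Δ.t (S.π.onA e)) :=
  fun y => ⟨p.onV (S.graph.t ((p.equivA e).symm y)), p.t_mem ((p.equivA e).symm y).2⟩

theorem transition_spec (p : Colouring S) (e : S.AT) (b : AS) (hb : b ∈ S.arcBundle e) :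
    (p.transition e ⟨p.onA b, (p.bijOn_A e).mapsTo hb⟩ : α) = p.onV (S.graph.t b) := by
  have h : (p.equivA e).symm ⟨p.onA b, (p.bijOn_A e).mapsTo hb⟩ = ⟨b, hb⟩ :=
    (Equiv.symm_apply_eq _).2 rfl
  simp only [transition, h]

/-- The local action of a scaffolding automorphism `g` at a vertex of `T`, with respect to `p`:
the permutation `p g p_v⁻¹` of `X(π(v))`. -/
noncomputable def localAction (p : Colouring S) (g : S.autSc) (q : S.VT) :
    Equiv.Perm (𝒢.X (S.π.onV q)) :=
  (p.equivV q).symm.trans <|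
    (Equiv.subtypeEquiv g.1.1 (S.act_eq_iff g q) :
      S.vertexBundle q ≃ S.vertexBundle (S.act g q)).trans <|
    (p.equivV (S.act g q)).trans <| Equiv.setCongr (congrArg 𝒢.X (S.π_act g q))

/-- The defining property of the local action: `p g(w) = g_v p(w)` for all `w` in `[v]`. -/
theorem localAction_spec (p : Colouring S) (g : S.autSc) (q : S.VT) (w : VS)
    (hw : w ∈ S.vertexBundle q) :
    (p.localAction g q ⟨p.onV w, (p.bijOn_V q).mapsTo hw⟩ : α) = p.onV (g.1.1 w) := by
  have h : (p.equivV q).symm ⟨p.onV w, (p.bijOn_V q).mapsTo hw⟩ = ⟨w, hw⟩ :=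
    (Equiv.symm_apply_eq _).2 rfl
  simp only [localAction, Equiv.trans_apply, h]
  rfl

theorem mem_of_coe_eq (𝒢 : GraphOfGroupActions V A α β) {u v : V} (huv : u = v)
    {γ : Equiv.Perm (𝒢.X u)} {δ : Equiv.Perm (𝒢.X v)}
    (h : ∀ (x : 𝒢.X u) (y : 𝒢.X v), (x : α) = y → (γ x : α) = δ y) (hγ : γ ∈ 𝒢.G u) :
    δ ∈ 𝒢.G v := by
  subst huv
  have : γ = δ := Equiv.ext fun x => Subtype.ext (h x x rfl)
  exact this ▸ hγ

theorem exists_rep (p : Colouring S) (q : S.VT) (x : 𝒢.X (S.π.onV q)) :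
    ∃ w, ∃ hw : w ∈ S.vertexBundle q, x = ⟨p.onV w, (p.bijOn_V q).mapsTo hw⟩ := by
  obtain ⟨w, hw, h⟩ := (p.bijOn_V q).surjOn x.2
  exact ⟨w, hw, Subtype.ext h.symm⟩

end Colouring

/-- A legal colouring of `Σ`. -/
structure LegalColouring {V A α β VS AS : Type*} {𝒢 : GraphOfGroupActions V A α β}
    (S : ScaffoldingFrame 𝒢 VS AS) extends Colouring S where
  adhesion : ∀ e : S.AT, 𝒢.Δ.rev (S.π.onA e) ≠ S.π.onA e →
    𝒢.IsAdhesionMap (S.π.onA e) (toColouring.transition e)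
  adhesion_self_reverse : ∀ e : S.AT, 𝒢.Δ.rev (S.π.onA e) = S.π.onA e →
    (𝒢.IsAdhesionMap (S.π.onA e) (toColouring.transition e) ∧
      𝒢.IsTwistedAdhesionMap (S.π.onA (S.T.rev e)) (toColouring.transition (S.T.rev e))) ∨
    (𝒢.IsTwistedAdhesionMap (S.π.onA e) (toColouring.transition e) ∧
      𝒢.IsAdhesionMap (S.π.onA (S.T.rev e)) (toColouring.transition (S.T.rev e)))
  existsUnique_arc : ∀ (q : S.VT) (b : A), 𝒢.Δ.t b = S.π.onV q →
    ∀ B : Set α, 𝒢.IsAdhesionSet b B →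
      ∃! e : S.AT, S.π.onA e = b ∧ S.T.t e = q ∧
        (Set.range fun y => (toColouring.transition e y : α)) = B

/-- A scaffolding for the graph of group actions `𝒢`. -/
structure Scaffolding {V A α β : Type*} (𝒢 : GraphOfGroupActions V A α β) (VS AS : Type*)
    extends ScaffoldingFrame 𝒢 VS AS where
  isTree : toScaffoldingFrame.T.IsTree
  bundle_empty : ∀ a : AS, ¬ rel (graph.o a) (graph.t a)
  exists_legalColouring : Nonempty (LegalColouring toScaffoldingFrame)

section

variable {V A α β VS AS : Type*} {𝒢 : GraphOfGroupActions V A α β}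
  {S : ScaffoldingFrame 𝒢 VS AS}

/-- The universal group of `𝒢`, defined with respect to a legal colouring `p` of `Σ`: the
group of all scaffolding automorphisms whose local action at every vertex `v` of `T` is in
`G(π(v))`. -/
def universalGroup (p : LegalColouring S) : Subgroup S.autSc where
  carrier := {g | ∀ q : S.VT, p.localAction g q ∈ 𝒢.G (S.π.onV q)}
  one_mem' := by
    intro q
    have : p.localAction 1 q = 1 := by
      refine Equiv.ext fun x => Subtype.ext ?_
      obtain ⟨w, hw, rfl⟩ := p.exists_rep q x
      exact p.localAction_spec 1 q w hw
    rw [this]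
    exact one_mem _
  mul_mem' := by
    intro g h hg hh q
    let δ : Equiv.Perm (𝒢.X (S.π.onV q)) := p.localAction (g * h) q * (p.localAction h q)⁻¹
    have hδ : δ ∈ 𝒢.G (S.π.onV q) := by
      refine Colouring.mem_of_coe_eq 𝒢 (S.π_act h q) (γ := p.localAction g (S.act h q)) ?_
        (hg (S.act h q))
      intro x y hxy
      obtain ⟨z, rfl⟩ := (p.localAction h q).surjective y
      obtain ⟨w, hw, rfl⟩ := p.exists_rep q z
      have hw' : h.1.1 w ∈ S.vertexBundle (S.act h q) := (S.act_eq_iff h q w).1 hw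
      have hx : x = ⟨p.onV (h.1.1 w), (p.bijOn_V _).mapsTo hw'⟩ :=
        Subtype.ext (hxy.trans (p.localAction_spec h q w hw))
      subst hx
      rw [p.localAction_spec g _ _ hw']
      refine (p.localAction_spec (g * h) q w hw).symm.trans ?_
      simp [δ]
    have : p.localAction (g * h) q = δ * p.localAction h q := by simp [δ]
    rw [this]
    exact mul_mem hδ (hh q)
  inv_mem' := by
    intro g hg q
    refine Colouring.mem_of_coe_eq 𝒢 (S.π_act g⁻¹ q)
      (γ := (p.localAction g (S.act g⁻¹ q))⁻¹) ?_ (inv_mem (hg (S.act g⁻¹ q)))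
    intro x y hxy
    obtain ⟨w, hw, rfl⟩ := p.exists_rep q y
    rw [p.localAction_spec g⁻¹ q w hw]
    have hw' : g⁻¹.1.1 w ∈ S.vertexBundle (S.act g⁻¹ q) := (S.act_eq_iff g⁻¹ q w).1 hw
    have hx : (p.localAction g (S.act g⁻¹ q))⁻¹ x =
        ⟨p.onV (g⁻¹.1.1 w), (p.bijOn_V _).mapsTo hw'⟩ := by
      rw [Equiv.Perm.inv_eq_iff_eq]
      refine Subtype.ext ?_
      rw [p.localAction_spec g _ _ hw']
      simpa using hxy
    rw [hx]

/-- A group of scaffolding automorphisms is locally-`𝒢` if, for some legal colouring `p'`, all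
local actions of its elements with respect to `p'` are in the groups `G(π(v))`. -/
def IsLocally (𝒢 : GraphOfGroupActions V A α β) {S : ScaffoldingFrame 𝒢 VS AS}
    (H : Subgroup S.autSc) : Prop :=
  ∃ p' : LegalColouring S, ∀ h ∈ H, ∀ q : S.VT, p'.localAction h q ∈ 𝒢.G (S.π.onV q)

end

/-! The core is that any two legal colourings `p₁`, `p₂` differ by a scaffolding automorphism, up to
the groups `G(v)` (`exists_autSc`). Given this, let `φ` carry the colouring `p'` that witnesses
local-`𝒢`-ness to `p`. Each bundle map of `φ h φ⁻¹` is then a composite of steps from `p` to `p'`,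
within `p'`, and back to `p`. Each step acts through an element of the relevant `G(v)`, so `φ h φ⁻¹`
lies in the universal group.

The automorphism is built outwards from a root of the tree `T`, one bundle at a time. A bundle map
at the terminus of an arc `e`, acting through `G`, sends the adhesion set of `e` to an adhesion set.
Condition 3 for `p₂` provides an arc `e'` with that set, and the discrepancy between the two
adhesion maps is an element of `H`. Multiplied by the possible twists it stays in `H`, so it extends
to an element of `G` at the origin (`exists_extension`).

The glued map covers a map `f` of `T`. Uniqueness in condition 3 for `p₁` makes `f` locally
injective; existence for `p₁` with uniqueness for `p₂` makes it locally surjective. On a tree this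
forces bijectivity. Arcs of the scaffolding are determined by their end points, so the vertex map
determines the arc map. -/

/-! ### Trees and locally injective or surjective maps -/

namespace SimpleGraph

variable {V W : Type*} {G : SimpleGraph V} {G' : SimpleGraph W}

/-- In a tree, a vertex has at most one neighbour closer to the root. -/
theorem IsTree.eq_of_adj_of_dist (hG : G.IsTree) {r w u u' : V} (h : G.Adj u w) (h' : G.Adj u' w)
    (hd : G.dist r w = G.dist r u + 1) (hd' : G.dist r w = G.dist r u' + 1) : u = u' := by
  obtain ⟨p, hp⟩ := (hG.connected r u).exists_walk_length_eq_dist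
  obtain ⟨p', hp'⟩ := (hG.connected r u').exists_walk_length_eq_dist
  have h1 : (p.concat h).IsPath := Walk.isPath_of_length_eq_dist _ (by simp [hp, hd])
  have h2 : (p'.concat h').IsPath := Walk.isPath_of_length_eq_dist _ (by simp [hp', hd'])
  have := congrArg Walk.penultimate (congrArg Subtype.val
    ((hG.isAcyclic.subsingleton_path r w).elim ⟨_, h1⟩ ⟨_, h2⟩))
  simpa using this

/-- If two consecutive edges of a path had the same image, local injectivity at their common vertex
would identify its two neighbours on the path. In an acyclic target, a walk without backtracking is
a path. -/
theorem Walk.IsPath.isChain_edges_map {f : G →g G'}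
    (hf : ∀ u v w, G.Adj u v → G.Adj w v → f u = f w → u = w) {u v : V} {p : G.Walk u v}
    (hp : p.IsPath) : List.IsChain (· ≠ ·) (p.map f).edges := by
  induction p with
  | nil => simp
  | @cons u v w h q ih =>
    cases q with
    | nil => simp
    | @cons _ x _ h' t =>
      have ih := ih hp.of_cons
      simp only [Walk.map_cons, Walk.edges_cons, List.isChain_cons_cons] at ih ⊢
      refine ⟨fun he => ?_, ih⟩
      have hux : u ≠ x := by
        rintro rfl
        have := hp.support_nodup
        simp at this
      rw [Sym2.eq_swap, Sym2.congr_right] at he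
      exact hux (hf u v x h h'.symm he)

/-- A locally injective homomorphism from a connected graph to an acyclic graph is injective. -/
theorem Connected.injective_of_locally_injective (hG : G.Connected) (hG' : G'.IsAcyclic)
    (f : G →g G') (hf : ∀ u v w, G.Adj u v → G.Adj w v → f u = f w → u = w) :
    Function.Injective f := by
  intro u v huv
  obtain ⟨p, hp, -⟩ := (hG u v).exists_path_of_dist
  -- The image of a path from `u` to `v` is a path, but it is closed since `f u = f v`, so it has
  -- length zero.
  have h := (hG'.isPath_iff_isChain _).2 (hp.isChain_edges_map hf)
  cases p with
  | nil => rfl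
  | cons a q =>
    exfalso
    have := h.support_nodup
    rw [Walk.map_cons, Walk.support_cons, List.nodup_cons] at this
    refine this.1 ?_
    rw [huv]
    exact Walk.end_mem_support (q.map f)

/-- A locally surjective map between graphs with connected target is surjective. -/
theorem Connected.surjective_of_locally_surjective [Nonempty V] (hG' : G'.Connected) (f : V → W)
    (hf : ∀ v w, G'.Adj (f v) w → ∃ u, f u = w) : Function.Surjective f := by
  intro w
  obtain ⟨v⟩ := ‹Nonempty V›
  obtain ⟨p⟩ := hG' (f v) w
  generalize hx : f v = x at p
  induction p generalizing v with
  | nil => exact ⟨v, hx⟩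
  | cons h q ih =>
    subst hx
    obtain ⟨u, hu⟩ := hf _ _ h
    exact ih u hu

end SimpleGraph

/-! ### Twists and the groups on arcs -/

namespace GraphOfGroupActions

variable {V A α β : Type*} (𝒢 : GraphOfGroupActions V A α β)

/-- The permutations by which the embeddings of an arc bundle into the two adjacent vertex bundles
may differ: the identity, or the inversion agent and its inverse for a self-reverse arc. -/
def twists (b : A) : Set (Equiv.Perm (𝒢.Y b)) :=
  {κ | κ = 1 ∧ 𝒢.Δ.rev b ≠ b ∨ ∃ hb, κ = 𝒢.agent b hb ∨ κ = (𝒢.agent b hb)⁻¹}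

/-- The agent `a` normalises `H` and `a ^ 2 ∈ H`, so `a` and `a⁻¹` lie in one coset of `H`; for
instance `a h a = (a h a⁻¹) a²`. Hence two colourings may twist an arc in opposite directions and
still differ by an element of `H`. -/
theorem mul_mul_inv_mem_of_twists {b : A} {κ κ' h : Equiv.Perm (𝒢.Y b)} (hκ : κ ∈ 𝒢.twists b)
    (hκ' : κ' ∈ 𝒢.twists b) (hh : h ∈ 𝒢.H b) : κ * h * κ'⁻¹ ∈ 𝒢.H b := by
  by_cases hb : 𝒢.Δ.rev b = b
  · set a := 𝒢.agent b hb with ha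
    have conj : ∀ x ∈ 𝒢.H b, a * x * a⁻¹ ∈ 𝒢.H b := fun x hx => by
      rw [← 𝒢.agent_conj b hb]
      exact ⟨x, hx, rfl⟩
    have conj' : ∀ x ∈ 𝒢.H b, a⁻¹ * x * a ∈ 𝒢.H b := fun x hx => by
      rw [← 𝒢.agent_conj b hb] at hx
      obtain ⟨z, hz, rfl⟩ := hx
      simpa [mul_assoc, ← ha] using hz
    have sq : a ^ 2 ∈ 𝒢.H b := 𝒢.agent_sq b hb
    have h1 : κ = a ∨ κ = a⁻¹ := by
      rcases hκ with ⟨-, h⟩ | ⟨_, h⟩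
      · exact absurd hb h
      · exact h
    have h2 : κ' = a ∨ κ' = a⁻¹ := by
      rcases hκ' with ⟨-, h⟩ | ⟨_, h⟩
      · exact absurd hb h
      · exact h
    rcases h1 with rfl | rfl <;> rcases h2 with h2 | h2 <;> rw [h2]
    · exact conj h hh
    · convert mul_mem (conj h hh) sq using 1
      group
    · convert mul_mem (conj' h hh) (inv_mem sq) using 1
      group
    · simpa using conj' h hh
  · have h1 : κ = 1 := by
      rcases hκ with ⟨h, -⟩ | ⟨h, -⟩
      · exact h
      · exact absurd h hb
    have h2 : κ' = 1 := by
      rcases hκ' with ⟨h, -⟩ | ⟨h, -⟩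
      · exact h
      · exact absurd h hb
    simpa [h1, h2] using hh

theorem Φ_rev_embeds {b : A} {h : Equiv.Perm (𝒢.Y b)} (hh : h ∈ 𝒢.H b) :
    ∃ g ∈ 𝒢.G (𝒢.Δ.t (𝒢.Δ.rev b)), ∀ (y : 𝒢.Y b) (z z' : 𝒢.Y (𝒢.Δ.rev b)),
      (z : β) = y → (z' : β) = h y → g (𝒢.Φ _ z) = 𝒢.Φ _ z' := by
  rw [← 𝒢.H_rev] at hh
  obtain ⟨h₀, hh₀, rfl⟩ := hh
  obtain ⟨g, hg, hgΦ⟩ := 𝒢.Φ_embeds _ h₀ hh₀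
  refine ⟨g, hg, fun y z z' hz hz' => ?_⟩
  rw [hgΦ]
  congr 1
  refine Subtype.ext (hz'.trans ?_).symm
  have : (Equiv.setCongr (𝒢.Y_rev b)).symm y = z := Subtype.ext hz.symm
  simp [Equiv.permCongrHom, Equiv.permCongr_apply, this]

theorem exists_mem_of_eq {b b' : A} (hb : b' = b) {γ : Equiv.Perm (𝒢.X (𝒢.Δ.t b))}
    (hγ : γ ∈ 𝒢.G (𝒢.Δ.t b)) :
    ∃ γ' ∈ 𝒢.G (𝒢.Δ.t b'), ∀ (z : 𝒢.Y b) (z' : 𝒢.Y b'), (z' : β) = z →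
      (γ (𝒢.Φ b z) : α) = γ' (𝒢.Φ b' z') := by
  subst hb
  refine ⟨γ, hγ, fun z z' h => ?_⟩
  rw [Subtype.ext h]

end GraphOfGroupActions

/-! ### Adhesion maps read off a colouring -/

namespace Colouring

variable {V A α β VS AS : Type*} {𝒢 : GraphOfGroupActions V A α β}
  {S : ScaffoldingFrame 𝒢 VS AS}

theorem transition_eq (p : Colouring S) {e : S.AT} {c : AS} (hc : S.amk c = e)
    (y : 𝒢.Y (S.π.onA e)) (hy : (y : β) = p.onA c) :
    (p.transition e y : α) = p.onV (S.graph.t c) := by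
  have : y = ⟨p.onA c, (p.bijOn_A e).mapsTo hc⟩ := Subtype.ext hy
  rw [this]
  exact p.transition_spec e c hc

theorem range_transition (p : Colouring S) (e : S.AT) :
    (Set.range fun y => (p.transition e y : α)) =
      (fun c => p.onV (S.graph.t c)) '' S.arcBundle e := by
  ext x
  constructor
  · rintro ⟨y, rfl⟩
    obtain ⟨c, hc, hy⟩ := (p.bijOn_A e).surjOn y.2
    exact ⟨c, hc, (p.transition_eq hc y hy.symm).symm⟩
  · rintro ⟨c, hc, rfl⟩
    exact ⟨_, p.transition_spec e c hc⟩

theorem exists_of_isAdhesionMap (p : Colouring S) {e : S.AT}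
    (h : 𝒢.IsAdhesionMap (S.π.onA e) (p.transition e)) {b : A} (hb : S.π.onA e = b) :
    ∃ γ ∈ 𝒢.G (𝒢.Δ.t b), ∀ c, S.amk c = e → ∀ y : 𝒢.Y b, (y : β) = p.onA c →
      p.onV (S.graph.t c) = γ (𝒢.Φ b y) := by
  subst hb
  obtain ⟨γ, hγ, h⟩ := h
  exact ⟨γ, hγ, fun c hc y hy => by rw [← h, p.transition_eq hc y hy]⟩

theorem exists_of_isTwistedAdhesionMap (p : Colouring S) {e : S.AT}
    (h : 𝒢.IsTwistedAdhesionMap (S.π.onA e) (p.transition e)) {b : A} (hb : S.π.onA e = b) :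
    ∃ ha, ∃ γ ∈ 𝒢.G (𝒢.Δ.t b), ∀ c, S.amk c = e → ∀ y : 𝒢.Y b, (y : β) = p.onA c →
      p.onV (S.graph.t c) = γ (𝒢.Φ b (𝒢.agent b ha y)) := by
  subst hb
  obtain ⟨ha, γ, hγ, h⟩ := h
  exact ⟨ha, γ, hγ, fun c hc y hy => by rw [← h, p.transition_eq hc y hy]⟩

end Colouring

namespace LegalColouring

variable {V A α β VS AS : Type*} {𝒢 : GraphOfGroupActions V A α β}
  {S : ScaffoldingFrame 𝒢 VS AS}

/-- The embeddings of an arc bundle into the two adjacent vertex bundles, in terms of a legal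
colouring. -/
theorem exists_twist (p : LegalColouring S) {e : S.AT} {b : A} (hb : S.π.onA e = b) :
    ∃ κ ∈ 𝒢.twists b, ∃ γ₁ ∈ 𝒢.G (𝒢.Δ.t b), ∃ γ₂ ∈ 𝒢.G (𝒢.Δ.t (𝒢.Δ.rev b)),
      ∃ σ : Equiv.Perm (𝒢.Y b), ∀ c, S.amk c = e → ∀ y : 𝒢.Y b, (y : β) = p.onA c →
        p.onV (S.graph.t c) = γ₁ (𝒢.Φ b (σ y)) ∧
        ∀ z : 𝒢.Y (𝒢.Δ.rev b), (z : β) = κ (σ y) → p.onV (S.graph.o c) = γ₂ (𝒢.Φ _ z) := by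
  have hrev : S.π.onA (S.T.rev e) = 𝒢.Δ.rev b := by rw [S.π.map_rev, hb]
  have hc' : ∀ c, S.amk c = e → S.amk (S.graph.rev c) = S.T.rev e := by rintro c rfl; rfl
  have ho : ∀ c, p.onV (S.graph.o c) = p.onV (S.graph.t (S.graph.rev c)) := fun c => by
    rw [S.graph.o_eq]
  by_cases hself : 𝒢.Δ.rev b = b
  · rcases p.adhesion_self_reverse e (by rw [hb, hself]) with ⟨h1, h2⟩ | ⟨h1, h2⟩
    · obtain ⟨γ₁, hγ₁, h1⟩ := p.exists_of_isAdhesionMap h1 hb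
      obtain ⟨ha, γ, hγ, h2⟩ := p.exists_of_isTwistedAdhesionMap h2 (hrev.trans hself)
      obtain ⟨γ₂, hγ₂, h3⟩ := 𝒢.exists_mem_of_eq hself hγ
      refine ⟨𝒢.agent b ha, Or.inr ⟨ha, Or.inl rfl⟩, γ₁, hγ₁, γ₂, hγ₂, 1, fun c hc y hy =>
        ⟨h1 c hc y hy, fun z hz => ?_⟩⟩
      rw [ho, h2 _ (hc' c hc) y (hy.trans (p.map_rev c))]
      exact h3 _ _ hz
    · obtain ⟨ha, γ₁, hγ₁, h1⟩ := p.exists_of_isTwistedAdhesionMap h1 hb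
      obtain ⟨γ, hγ, h2⟩ := p.exists_of_isAdhesionMap h2 (hrev.trans hself)
      obtain ⟨γ₂, hγ₂, h3⟩ := 𝒢.exists_mem_of_eq hself hγ
      -- The twist sits at the terminus here. Taking `σ` to be the agent absorbs it, so it reappears
      -- inverted at the origin.
      refine ⟨(𝒢.agent b ha)⁻¹, Or.inr ⟨ha, Or.inr rfl⟩, γ₁, hγ₁, γ₂, hγ₂, 𝒢.agent b ha,
        fun c hc y hy => ⟨h1 c hc y hy, fun z hz => ?_⟩⟩
      rw [ho, h2 _ (hc' c hc) y (hy.trans (p.map_rev c))]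
      exact h3 _ _ (by simpa using hz)
  · obtain ⟨γ₁, hγ₁, h1⟩ := p.exists_of_isAdhesionMap (p.adhesion e (by rwa [hb])) hb
    obtain ⟨γ₂, hγ₂, h2⟩ := p.exists_of_isAdhesionMap
      (p.adhesion (S.T.rev e) (by rw [hrev, 𝒢.Δ.rev_rev]; exact fun h => hself h.symm)) hrev
    refine ⟨1, Or.inl ⟨rfl, hself⟩, γ₁, hγ₁, γ₂, hγ₂, 1, fun c hc y hy =>
      ⟨h1 c hc y hy, fun z hz => ?_⟩⟩
    rw [ho, h2 _ (hc' c hc) z (hz.trans (hy.trans (p.map_rev c)))]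

end LegalColouring

/-! ### Bundle maps compatible with two colourings -/

namespace Colouring

variable {V A α β VS AS : Type*} {𝒢 : GraphOfGroupActions V A α β}
  {S : ScaffoldingFrame 𝒢 VS AS}

/-- The map `θ` takes the vertex bundle of `q` to that of `r` and, with respect to the colourings
`p₁` and `p₂`, acts as an element of the group at the common image of `q` and `r`. -/
def Compat (p₁ p₂ : Colouring S) (q r : S.VT) (θ : VS → VS) : Prop :=
  ∃ v, S.π.onV q = v ∧ S.π.onV r = v ∧ ∃ γ ∈ 𝒢.G v, ∀ w, S.vmk w = q →
    S.vmk (θ w) = r ∧ ∀ x : 𝒢.X v, (x : α) = p₁.onV w → p₂.onV (θ w) = γ x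

/-- The vertex of the base graph may be named by any propositionally equal expression, such as
`π(t(e))` or `t(π(e))`, which avoids transporting permutations. -/
theorem Compat.exists_perm {p₁ p₂ : Colouring S} {q r : S.VT} {θ : VS → VS}
    (h : Compat p₁ p₂ q r θ) {v : V} (hv : S.π.onV q = v) :
    S.π.onV r = v ∧ ∃ γ ∈ 𝒢.G v, ∀ w, S.vmk w = q →
      S.vmk (θ w) = r ∧ ∀ x : 𝒢.X v, (x : α) = p₁.onV w → p₂.onV (θ w) = γ x := by
  obtain ⟨v', hv', h⟩ := h
  obtain rfl : v' = v := hv'.symm.trans hv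
  exact h

theorem onV_mem (p : Colouring S) {q : S.VT} {v : V} (hv : S.π.onV q = v) {w : VS}
    (hw : S.vmk w = q) : p.onV w ∈ 𝒢.X v := by
  subst hv
  exact (p.bijOn_V q).mapsTo hw

theorem eq_of_onV_eq (p : Colouring S) {q : S.VT} {w w' : VS} (hw : S.vmk w = q)
    (hw' : S.vmk w' = q) (h : p.onV w = p.onV w') : w = w' :=
  (p.bijOn_V q).injOn hw hw' h

theorem onA_mem (p : Colouring S) {e : S.AT} {b : A} (hb : S.π.onA e = b) {c : AS}
    (hc : S.amk c = e) : p.onA c ∈ 𝒢.Y b := by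
  subst hb
  exact (p.bijOn_A e).mapsTo hc

theorem exists_onA_eq (p : Colouring S) {e : S.AT} {b : A} (hb : S.π.onA e = b)
    (y : 𝒢.Y b) : ∃ c, S.amk c = e ∧ (y : β) = p.onA c := by
  subst hb
  obtain ⟨c, hc, h⟩ := (p.bijOn_A e).surjOn y.2
  exact ⟨c, hc, h.symm⟩

theorem exists_compat (p₁ p₂ : Colouring S) {q r : S.VT} {v : V} (hq : S.π.onV q = v)
    (hr : S.π.onV r = v) {γ : Equiv.Perm (𝒢.X v)} :
    ∃ θ : VS → VS, ∀ w, S.vmk w = q →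
      S.vmk (θ w) = r ∧ ∀ x : 𝒢.X v, (x : α) = p₁.onV w → p₂.onV (θ w) = γ x := by
  have : ∀ w, ∃ w', S.vmk w = q →
      S.vmk w' = r ∧ ∀ x : 𝒢.X v, (x : α) = p₁.onV w → p₂.onV w' = γ x := by
    intro w
    by_cases hw : S.vmk w = q
    · subst hr
      obtain ⟨w', hw', h⟩ := (p₂.bijOn_V r).surjOn (γ ⟨p₁.onV w, p₁.onV_mem hq hw⟩).2
      refine ⟨w', fun _ => ⟨hw', fun x hx => ?_⟩⟩
      rw [h]
      congr 2
      exact Subtype.ext hx.symm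
    -- Only the values on the bundle of `q` matter; elsewhere the identity is a default.
    · exact ⟨w, fun h => absurd h hw⟩
  choose θ hθ using this
  exact ⟨θ, hθ⟩

theorem Compat.refl (p₁ p₂ : Colouring S) (q : S.VT) : ∃ θ, Compat p₁ p₂ q q θ := by
  obtain ⟨θ, h⟩ := exists_compat p₁ p₂ (q := q) rfl rfl (γ := 1)
  exact ⟨θ, _, rfl, rfl, 1, one_mem _, h⟩

theorem Compat.congr {p₁ p₂ : Colouring S} {q r : S.VT} {θ θ' : VS → VS}
    (h : Compat p₁ p₂ q r θ) (hθ : ∀ w, S.vmk w = q → θ w = θ' w) : Compat p₁ p₂ q r θ' := by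
  obtain ⟨v, hq, hr, γ, hγ, h⟩ := h
  exact ⟨v, hq, hr, γ, hγ, fun w hw => hθ w hw ▸ h w hw⟩

theorem Compat.comp {p₁ p₂ p₃ : Colouring S} {q r s : S.VT} {θ θ' : VS → VS}
    (h' : Compat p₂ p₃ r s θ') (h : Compat p₁ p₂ q r θ) : Compat p₁ p₃ q s (θ' ∘ θ) := by
  obtain ⟨v, hq, hr, γ, hγ, h⟩ := h
  obtain ⟨hs, γ', hγ', h'⟩ := h'.exists_perm hr
  refine ⟨v, hq, hs, γ' * γ, mul_mem hγ' hγ, fun w hw => ⟨(h' _ (h w hw).1).1, fun x hx => ?_⟩⟩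
  exact (h' _ (h w hw).1).2 _ ((h w hw).2 x hx).symm

theorem Compat.exists_symm {p₁ p₂ : Colouring S} {q r : S.VT} {θ : VS → VS}
    (h : Compat p₁ p₂ q r θ) :
    ∃ θ', Compat p₂ p₁ r q θ' ∧ ∀ w, S.vmk w = r → θ (θ' w) = w := by
  obtain ⟨v, hq, hr, γ, hγ, h⟩ := h
  obtain ⟨θ', hθ'⟩ := exists_compat p₂ p₁ hr hq (γ := γ⁻¹)
  refine ⟨θ', ⟨v, hr, hq, γ⁻¹, inv_mem hγ, hθ'⟩, fun w hw => ?_⟩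
  obtain ⟨h1, h2⟩ := hθ' w hw
  refine p₂.eq_of_onV_eq (h _ h1).1 hw ?_
  rw [(h _ h1).2 _ (h2 ⟨_, p₂.onV_mem hr hw⟩ rfl).symm]
  simp

theorem Compat.symm {p₁ p₂ : Colouring S} {q r : S.VT} {θ : Equiv.Perm VS}
    (h : Compat p₁ p₂ q r θ) : Compat p₂ p₁ r q θ.symm := by
  obtain ⟨θ', h', hθ'⟩ := h.exists_symm
  exact h'.congr fun w hw => (θ.symm_apply_eq.2 (hθ' w hw).symm).symm

theorem Compat.injOn {p₁ p₂ : Colouring S} {q r : S.VT} {θ : VS → VS}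
    (h : Compat p₁ p₂ q r θ) {w w' : VS} (hw : S.vmk w = q) (hw' : S.vmk w' = q)
    (hθ : θ w = θ w') : w = w' := by
  obtain ⟨v, hq, hr, γ, hγ, h⟩ := h
  refine p₁.eq_of_onV_eq hw hw' ?_
  have h1 := (h w hw).2 ⟨_, p₁.onV_mem hq hw⟩ rfl
  have h2 := (h w' hw').2 ⟨_, p₁.onV_mem hq hw'⟩ rfl
  rw [hθ, h2] at h1
  simpa using γ.injective (Subtype.ext h1.symm)

theorem Compat.map_vmk {p₁ p₂ : Colouring S} {q r : S.VT} {θ : VS → VS}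
    (h : Compat p₁ p₂ q r θ) {w : VS} (hw : S.vmk w = q) : S.vmk (θ w) = r := by
  obtain ⟨v, -, -, γ, -, h⟩ := h
  exact (h w hw).1

/-- This translates membership in the universal group into `Compat`, which, unlike the local action,
can be composed across different colourings. -/
theorem compat_act_iff (p : Colouring S) (g : S.autSc) (q : S.VT) :
    Compat p p q (S.act g q) g.1.1 ↔ p.localAction g q ∈ 𝒢.G (S.π.onV q) := by
  constructor
  · intro h
    obtain ⟨-, γ, hγ, h⟩ := h.exists_perm rfl
    convert hγ
    refine Equiv.ext fun x => Subtype.ext ?_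
    obtain ⟨w, hw, rfl⟩ := p.exists_rep q x
    rw [p.localAction_spec g q w hw]
    exact (h w hw).2 _ rfl
  · intro h
    refine ⟨_, rfl, S.π_act g q, _, h, fun w hw => ⟨(S.act_eq_iff g q w).1 hw, fun x hx => ?_⟩⟩
    rw [← p.localAction_spec g q w hw]
    congr 2
    exact Subtype.ext hx.symm

/-- The map `θ` on vertices takes the arc bundle of `e` onto an arc bundle of the same type. -/
def MapsArcBundle (S : ScaffoldingFrame 𝒢 VS AS) (θ : VS → VS) (e e' : S.AT) : Prop :=
  S.π.onA e' = S.π.onA e ∧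
  (∀ c, S.amk c = e → ∃ d, S.amk d = e' ∧ S.graph.o d = θ (S.graph.o c) ∧
    S.graph.t d = θ (S.graph.t c)) ∧
  ∀ d, S.amk d = e' → ∃ c, S.amk c = e ∧ S.graph.o d = θ (S.graph.o c) ∧
    S.graph.t d = θ (S.graph.t c)

end Colouring

/-! ### Extending a bundle map along one arc -/

namespace LegalColouring

open Colouring

variable {V A α β VS AS : Type*} {𝒢 : GraphOfGroupActions V A α β}
  {S : ScaffoldingFrame 𝒢 VS AS}

/-- The image of an arc bundle in a vertex bundle is coloured by an adhesion set. -/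
theorem isAdhesionSet_image (p : LegalColouring S) {e : S.AT} {b : A} (hb : S.π.onA e = b) :
    𝒢.IsAdhesionSet b ((fun c => p.onV (S.graph.t c)) '' S.arcBundle e) := by
  obtain ⟨κ, -, γ₁, hγ₁, γ₂, -, σ, h⟩ := p.exists_twist hb
  refine ⟨γ₁, hγ₁, Set.ext fun x => ⟨?_, ?_⟩⟩
  · rintro ⟨c, hc, rfl⟩
    exact ⟨_, ((h c hc ⟨_, p.onA_mem hb hc⟩ rfl).1).symm⟩
  · rintro ⟨y, rfl⟩
    obtain ⟨c, hc, hy⟩ := p.exists_onA_eq hb (σ⁻¹ y)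
    exact ⟨c, hc, by simp [(h c hc _ hy).1]⟩

/-- Adhesion sets are closed under translation by `G`. This allows condition 3 for the second
colouring to be applied to the transported set. -/
theorem isAdhesionSet_image_of_compat (p₁ : LegalColouring S) {p₂ : Colouring S} {e : S.AT}
    {r : S.VT} {θ : VS → VS} (h : Compat p₁.toColouring p₂ (S.T.t e) r θ) :
    𝒢.IsAdhesionSet (S.π.onA e) ((fun c => p₂.onV (θ (S.graph.t c))) '' S.arcBundle e) := by
  obtain ⟨hr, γ, hγ, h⟩ := h.exists_perm (S.π.map_t e)
  obtain ⟨γ₁, hγ₁, h₁⟩ := p₁.isAdhesionSet_image (e := e) rfl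
  have key : ∀ c ∈ S.arcBundle e, ∀ x : 𝒢.X (𝒢.Δ.t (S.π.onA e)),
      (x : α) = p₁.onV (S.graph.t c) → p₂.onV (θ (S.graph.t c)) = γ x := by
    rintro c rfl x hx
    exact (h _ rfl).2 x hx
  refine ⟨γ * γ₁, mul_mem hγ hγ₁, Set.ext fun x => ⟨?_, ?_⟩⟩
  · rintro ⟨c, hc, rfl⟩
    obtain ⟨y, hy⟩ := h₁.subset ⟨c, hc, rfl⟩
    exact ⟨y, (key c hc _ hy).symm⟩
  · rintro ⟨y, rfl⟩
    obtain ⟨c, hc, hy⟩ := h₁.superset ⟨y, rfl⟩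
    exact ⟨c, hc, key c hc _ hy.symm⟩

theorem eq_of_image_eq (p : LegalColouring S) {e e' : S.AT} (hπ : S.π.onA e = S.π.onA e')
    (ht : S.T.t e = S.T.t e')
    (h : (fun c => p.onV (S.graph.t c)) '' S.arcBundle e =
      (fun c => p.onV (S.graph.t c)) '' S.arcBundle e') : e = e' := by
  refine (p.existsUnique_arc (S.T.t e) (S.π.onA e) (S.π.map_t e).symm _
    (p.isAdhesionSet_image rfl)).unique ⟨rfl, rfl, p.range_transition e⟩
    ⟨hπ.symm, ht.symm, (p.range_transition e').trans h.symm⟩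

theorem exists_arc (p : LegalColouring S) {r : S.VT} {b : A} (hr : 𝒢.Δ.t b = S.π.onV r)
    {B : Set α} (hB : 𝒢.IsAdhesionSet b B) :
    ∃ e, S.π.onA e = b ∧ S.T.t e = r ∧ (fun c => p.onV (S.graph.t c)) '' S.arcBundle e = B := by
  obtain ⟨e, ⟨h1, h2, h3⟩, -⟩ := p.existsUnique_arc r b hr B hB
  exact ⟨e, h1, h2, (p.range_transition e).symm.trans h3⟩

/-- A compatible map of the vertex bundle at the terminus of an arc can be extended along the
arc. -/
theorem exists_extension (p₁ p₂ : LegalColouring S) (e : S.AT) {r : S.VT} {θ : VS → VS}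
    (h : Compat p₁.toColouring p₂.toColouring (S.T.t e) r θ) :
    ∃ e' θ', Compat p₁.toColouring p₂.toColouring (S.T.o e) (S.T.o e') θ' ∧ S.T.t e' = r ∧
      ∀ φ : VS → VS, (∀ w, S.vmk w = S.T.t e → φ w = θ w) →
        (∀ w, S.vmk w = S.T.o e → φ w = θ' w) → MapsArcBundle S φ e e' := by
  obtain ⟨hr, γ, hγ, hθ⟩ := h.exists_perm (S.π.map_t e)
  obtain ⟨e', hπ, ht, himg⟩ := p₂.exists_arc hr.symm (p₁.isAdhesionSet_image_of_compat h)
  obtain ⟨κ, hκ, γ₁, hγ₁, γ₂, hγ₂, σ, h₁⟩ := p₁.exists_twist (e := e) rfl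
  obtain ⟨κ', hκ', δ₁, hδ₁, δ₂, hδ₂, τ, h₂⟩ := p₂.exists_twist hπ
  have hte : ∀ c, S.amk c = e → S.vmk (S.graph.t c) = S.T.t e := by rintro c rfl; rfl
  have hoe : ∀ c, S.amk c = e → S.vmk (S.graph.o c) = S.T.o e := by rintro c rfl; rfl
  have hte' : ∀ c, S.amk c = e' → S.vmk (S.graph.t c) = r := by rintro c rfl; exact ht
  have hoe' : ∀ c, S.amk c = e' → S.vmk (S.graph.o c) = S.T.o e' := by rintro c rfl; rfl
  have hg : δ₁⁻¹ * γ * γ₁ ∈ 𝒢.G (𝒢.Δ.t (S.π.onA e)) :=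
    mul_mem (mul_mem (inv_mem hδ₁) hγ) hγ₁
  have hθt : ∀ c, S.amk c = e → ∀ y : 𝒢.Y (S.π.onA e), (y : β) = p₁.onA c →
      p₂.onV (θ (S.graph.t c)) = γ (γ₁ (𝒢.Φ _ (σ y))) := fun c hc y hy =>
    (hθ _ (hte c hc)).2 _ (h₁ c hc y hy).1.symm
  -- The arcs `e` and `e'` were matched to have corresponding adhesion sets, so `δ₁⁻¹ γ γ₁`
  -- stabilises the image of `Φ` and induces some `η ∈ H` there.
  obtain ⟨η, hη, hηΦ⟩ := 𝒢.Φ_induced _ _ hg (by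
    ext x
    constructor
    · rintro ⟨_, ⟨y, rfl⟩, rfl⟩
      obtain ⟨c, hc, hy⟩ := p₁.exists_onA_eq rfl (σ⁻¹ y)
      obtain ⟨d, hd, hcd⟩ := himg.superset ⟨c, hc, rfl⟩
      have := (h₂ d hd ⟨_, p₂.onA_mem hπ hd⟩ rfl).1
      refine ⟨τ ⟨_, p₂.onA_mem hπ hd⟩, ?_⟩
      have h3 := this.symm.trans (hcd.trans (hθt c hc _ hy))
      simp only [Equiv.Perm.mul_apply, Equiv.Perm.eq_inv_iff_eq]
      refine Subtype.ext (h3.trans ?_)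
      simp
    · rintro ⟨y, rfl⟩
      obtain ⟨d, hd, hy⟩ := p₂.exists_onA_eq hπ (τ⁻¹ y)
      obtain ⟨c, hc, hcd⟩ := himg.subset ⟨d, hd, rfl⟩
      refine ⟨_, ⟨σ ⟨_, p₁.onA_mem rfl hc⟩, rfl⟩, ?_⟩
      have h3 := (hθt c hc ⟨_, p₁.onA_mem rfl hc⟩ rfl).symm.trans (hcd.trans (h₂ d hd _ hy).1)
      simp only [Equiv.Perm.mul_apply, Equiv.Perm.inv_eq_iff_eq]
      refine Subtype.ext (h3.trans ?_)
      simp)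
  have hη' := 𝒢.mul_mul_inv_mem_of_twists hκ' hκ hη
  obtain ⟨g, hg', hgΦ⟩ := 𝒢.Φ_rev_embeds hη'
  have hrev : ∀ e'' : S.AT, S.π.onA e'' = S.π.onA e →
      S.π.onV (S.T.o e'') = 𝒢.Δ.t (𝒢.Δ.rev (S.π.onA e)) := fun e'' he => by
    rw [S.π.map_o, he, 𝒢.Δ.o_eq]
  -- An arc `c` coloured `y` is matched with `d` coloured `z` when `τ z = η (σ y)`. At the origins
  -- the parameters `κ (σ y)` and `κ' (τ z)` then differ by `κ' η κ⁻¹`, which `g` realises; this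
  -- forces the permutation `δ₂ g γ₂⁻¹`.
  obtain ⟨θ', hθ'⟩ := exists_compat p₁.toColouring p₂.toColouring (hrev e rfl) (hrev e' hπ)
    (γ := δ₂ * g * γ₂⁻¹)
  have key : ∀ c, S.amk c = e → ∀ d, S.amk d = e' → ∀ y z : 𝒢.Y (S.π.onA e),
      (y : β) = p₁.onA c → (z : β) = p₂.onA d → τ z = η (σ y) →
      S.graph.o d = θ' (S.graph.o c) ∧ S.graph.t d = θ (S.graph.t c) := by
    intro c hc d hd y z hy hz hyz
    obtain ⟨hc1, hc2⟩ := h₁ c hc y hy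
    obtain ⟨hd1, hd2⟩ := h₂ d hd z hz
    constructor
    · refine p₂.eq_of_onV_eq (hoe' d hd) (hθ' _ (hoe c hc)).1 ?_
      have hY := 𝒢.Y_rev (S.π.onA e)
      have hc2 := hc2 ⟨κ (σ y), by rw [hY]; exact (κ (σ y)).2⟩ rfl
      have hd2 := hd2 ⟨κ' (τ z), by rw [hY]; exact (κ' (τ z)).2⟩ rfl
      rw [hd2, (hθ' _ (hoe c hc)).2 _ hc2.symm]
      rw [← hgΦ (κ (σ y)) ⟨κ (σ y), by rw [hY]; exact (κ (σ y)).2⟩ _ rfl (by simp [hyz])]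
      simp
    · refine p₂.eq_of_onV_eq (hte' d hd) (hθ _ (hte c hc)).1 ?_
      rw [hd1, hθt c hc y hy, hyz, ← hηΦ]
      simp
  refine ⟨e', θ', ⟨_, hrev e rfl, hrev e' hπ, _, mul_mem (mul_mem hδ₂ hg') (inv_mem hγ₂), hθ'⟩,
    ht, fun φ hφ hφ' => ⟨hπ, fun c hc => ?_, fun d hd => ?_⟩⟩
  · obtain ⟨d, hd, hz⟩ := p₂.exists_onA_eq hπ (τ⁻¹ (η (σ ⟨_, p₁.onA_mem rfl hc⟩)))
    refine ⟨d, hd, ?_⟩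
    rw [hφ _ (hte c hc), hφ' _ (hoe c hc)]
    exact key c hc d hd ⟨_, p₁.onA_mem rfl hc⟩ _ rfl hz (by simp)
  · obtain ⟨c, hc, hz⟩ := p₁.exists_onA_eq rfl (σ⁻¹ (η⁻¹ (τ ⟨_, p₂.onA_mem hπ hd⟩)))
    refine ⟨c, hc, ?_⟩
    rw [hφ _ (hte c hc), hφ' _ (hoe c hc)]
    exact key c hc d hd _ ⟨_, p₂.onA_mem hπ hd⟩ hz rfl (by simp)

end LegalColouring

/-! ### Recursion on a rooted tree -/

namespace SerreGraph

variable {V A : Type*} {Γ : SerreGraph V A}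

theorem IsSimple.adj (h : Γ.IsSimple) (a : A) : Γ.toSimpleGraph.Adj (Γ.o a) (Γ.t a) :=
  ⟨h.no_loops a, a, rfl, rfl⟩

/-- Recursion along the arcs of a tree directed towards a root. -/
theorem IsTree.exists_rec (h : Γ.IsTree) (q₀ : V) {D : Type*} (x₀ : D) (F : A → D → D) :
    ∃ f : V → D, f q₀ = x₀ ∧ ∀ a, Γ.toSimpleGraph.dist q₀ (Γ.o a) =
      Γ.toSimpleGraph.dist q₀ (Γ.t a) + 1 → f (Γ.o a) = F a (f (Γ.t a)) := by
  classical
  let P (n : ℕ) (q : V) : Prop := ∃ a, Γ.o a = q ∧ Γ.toSimpleGraph.dist q₀ (Γ.t a) = n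
  -- The default `x₀` in the successor case is never reached when `n + 1` is the distance of `q`
  -- from the root.
  let g : ℕ → V → D := fun n => Nat.rec (fun _ => x₀)
    (fun n f q => if hq : P n q then F hq.choose (f (Γ.t hq.choose)) else x₀) n
  refine ⟨fun q => g (Γ.toSimpleGraph.dist q₀ q) q, ?_, fun a ha => ?_⟩
  · simp [g]
  · have hP : P (Γ.toSimpleGraph.dist q₀ (Γ.t a)) (Γ.o a) := ⟨a, rfl, rfl⟩
    obtain ⟨h1, h2⟩ := hP.choose_spec
    -- The neighbour towards the root is unique and the graph is simple, so the chosen arc can only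
    -- be `a`.
    have hu : hP.choose = a := by
      refine h.1.injective (Prod.ext h1 ?_)
      refine h.2.eq_of_adj_of_dist (r := q₀) (w := Γ.o a) ?_ (h.1.adj a).symm ?_ ha
      · have := (h.1.adj hP.choose).symm
        rwa [h1] at this
      · rw [ha, h2]
    change g (Γ.toSimpleGraph.dist q₀ (Γ.o a)) (Γ.o a) = _
    rw [ha]
    change (if hq : P _ _ then F hq.choose (g _ (Γ.t hq.choose)) else x₀) = _
    rw [dif_pos hP, hu]

/-- Every vertex of a connected graph other than the root has a neighbour closer to the root. -/
theorem exists_closer (h : Γ.toSimpleGraph.Connected) {q₀ q : V} (hq : q ≠ q₀) :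
    ∃ a, Γ.o a = q ∧
      Γ.toSimpleGraph.dist q₀ q = Γ.toSimpleGraph.dist q₀ (Γ.t a) + 1 := by
  obtain ⟨p, hp⟩ := (h q q₀).exists_walk_length_eq_dist
  cases p with
  | nil => exact absurd rfl hq
  | cons hadj p' =>
    obtain ⟨-, a, rfl, rfl⟩ := id hadj
    refine ⟨a, rfl, ?_⟩
    have h1 := SimpleGraph.dist_le p'
    have h2 := h.dist_triangle (u := Γ.o a) (v := Γ.t a) (w := q₀)
    have h3 := SimpleGraph.dist_eq_one_iff_adj.2 hadj
    rw [SimpleGraph.Walk.length_cons] at hp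
    rw [SimpleGraph.dist_comm, SimpleGraph.dist_comm (u := q₀)]
    lia

end SerreGraph

namespace ScaffoldingFrame

variable {V A α β VS AS : Type*} {𝒢 : GraphOfGroupActions V A α β}
  (S : ScaffoldingFrame 𝒢 VS AS)

theorem act_mul (g h : S.autSc) (q : S.VT) : S.act (g * h) q = S.act g (S.act h q) := by
  induction q using Quotient.inductionOn with
  | h v => rfl

theorem act_one (q : S.VT) : S.act 1 q = q := by
  induction q using Quotient.inductionOn with
  | h v => rfl

end ScaffoldingFrame

namespace Colouring

variable {V A α β VS AS : Type*} {𝒢 : GraphOfGroupActions V A α β}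
  {S : ScaffoldingFrame 𝒢 VS AS}

theorem MapsArcBundle.rev {θ : VS → VS} {e e' : S.AT} (h : MapsArcBundle S θ e e') :
    MapsArcBundle S θ (S.T.rev e) (S.T.rev e') := by
  have hr : ∀ c f, S.amk c = S.T.rev f → S.amk (S.graph.rev c) = f := fun c f hc => by
    rw [← S.T.rev_rev f, ← hc]
    rfl
  have hr' : ∀ c f, S.amk c = f → S.amk (S.graph.rev c) = S.T.rev f := by
    rintro c f rfl
    rfl
  obtain ⟨h1, h2, h3⟩ := h
  refine ⟨by rw [S.π.map_rev, S.π.map_rev, h1], fun c hc => ?_, fun d hd => ?_⟩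
  · obtain ⟨d, hd, ho, ht⟩ := h2 _ (hr c e hc)
    refine ⟨S.graph.rev d, hr' d e' hd, ?_, ?_⟩
    · rw [← S.graph.t_eq, ht, ← S.graph.o_eq]
    · rw [← S.graph.o_eq, ho, ← S.graph.t_eq]
  · obtain ⟨c, hc, ho, ht⟩ := h3 _ (hr d e' hd)
    refine ⟨S.graph.rev c, hr' c e hc, ?_, ?_⟩
    · rw [← S.graph.t_eq, ← ht, ← S.graph.o_eq]
    · rw [← S.graph.o_eq, ← ho, ← S.graph.t_eq]

end Colouring

/-! ### Gluing the bundle maps -/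

namespace LegalColouring

open Colouring

variable {V A α β VS AS : Type*} {𝒢 : GraphOfGroupActions V A α β}
  {S : ScaffoldingFrame 𝒢 VS AS}

/-- The map `φ` on the vertices of the scaffolding lies over `f` and is compatible with the
colourings on all vertex and arc bundles. -/
structure IsCompatible (p₁ p₂ : LegalColouring S) (f : S.VT → S.VT) (φ : VS → VS) : Prop where
  compat : ∀ q, Compat p₁.toColouring p₂.toColouring q (f q) φ
  exists_arc : ∀ e, ∃ e', S.T.o e' = f (S.T.o e) ∧ S.T.t e' = f (S.T.t e) ∧ MapsArcBundle S φ e e'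

theorem exists_isCompatible (hT : S.T.IsTree) (p₁ p₂ : LegalColouring S) :
    ∃ f φ, p₁.IsCompatible p₂ f φ := by
  obtain ⟨q₀⟩ := hT.2.connected.nonempty
  -- The recursion data at `q` are the image of `q` and a map that is meaningful only on the bundle
  -- of `q`. Incompatible data are returned unchanged, so that the step function is total.
  have hF : ∀ e (x : S.VT × (VS → VS)), ∃ x' : S.VT × (VS → VS),
      Compat p₁.toColouring p₂.toColouring (S.T.t e) x.1 x.2 → ∃ e',
        Compat p₁.toColouring p₂.toColouring (S.T.o e) x'.1 x'.2 ∧ S.T.t e' = x.1 ∧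
        S.T.o e' = x'.1 ∧ ∀ φ : VS → VS, (∀ w, S.vmk w = S.T.t e → φ w = x.2 w) →
          (∀ w, S.vmk w = S.T.o e → φ w = x'.2 w) → MapsArcBundle S φ e e' := by
    intro e x
    by_cases hx : Compat p₁.toColouring p₂.toColouring (S.T.t e) x.1 x.2
    · obtain ⟨e', θ', h1, h2, h3⟩ := p₁.exists_extension p₂ e hx
      exact ⟨(S.T.o e', θ'), fun _ => ⟨e', h1, h2, rfl, h3⟩⟩
    · exact ⟨x, fun h => absurd h hx⟩
  choose F hF using hF
  obtain ⟨θ₀, hθ₀⟩ := Compat.refl p₁.toColouring p₂.toColouring q₀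
  obtain ⟨D, hD₀, hD⟩ := hT.exists_rec q₀ (q₀, θ₀) F
  have hcompat : ∀ n q, S.T.toSimpleGraph.dist q₀ q = n →
      Compat p₁.toColouring p₂.toColouring q (D q).1 (D q).2 := by
    intro n
    induction n with
    | zero =>
      intro q hq
      obtain rfl : q₀ = q := hT.2.connected.dist_eq_zero_iff.1 hq
      rwa [hD₀]
    | succ n ih =>
      intro q hq
      obtain ⟨e, rfl, he⟩ := SerreGraph.exists_closer hT.2.connected
        (q₀ := q₀) (q := q) (by rintro rfl; simp at hq)
      rw [hD e he]
      obtain ⟨e', h, -⟩ := hF e (D (S.T.t e)) (ih _ (by lia))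
      exact h
  have harc : ∀ e, S.T.toSimpleGraph.dist q₀ (S.T.o e) =
      S.T.toSimpleGraph.dist q₀ (S.T.t e) + 1 → ∃ e', S.T.o e' = (D (S.T.o e)).1 ∧
        S.T.t e' = (D (S.T.t e)).1 ∧ MapsArcBundle S (fun w => (D (S.vmk w)).2 w) e e' := by
    intro e he
    obtain ⟨e', -, ht, ho, h⟩ := hF e (D (S.T.t e)) (hcompat _ _ rfl)
    rw [← hD e he] at ho h
    exact ⟨e', ho, ht, h _ (fun w hw => by rw [hw]) fun w hw => by rw [hw]⟩
  refine ⟨fun q => (D q).1, fun w => (D (S.vmk w)).2 w, fun q => ?_, fun e => ?_⟩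
  · exact (hcompat _ q rfl).congr fun w hw => by rw [hw]
  -- Either `e` or its reverse points towards the root.
  · rcases hT.2.dist_eq_dist_add_one_of_adj q₀ (hT.1.adj e) with he | he
    · exact harc e he
    · obtain ⟨e', ho, ht, h⟩ := harc (S.T.rev e) (by rwa [← S.T.t_eq, ← S.T.o_eq])
      refine ⟨S.T.rev e', ?_, ?_, ?_⟩
      · rw [← S.T.t_eq, ht, ← S.T.o_eq]
      · rw [← S.T.o_eq, ho, ← S.T.t_eq]
      · simpa only [S.T.rev_rev] using h.rev

/-- Such arcs share a bundle, on which the terminus map is injective because adhesion maps, twisted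
or not, are. -/
theorem eq_of_o_eq_of_t_eq (p : LegalColouring S) {c d : AS} (ho : S.graph.o c = S.graph.o d)
    (ht : S.graph.t c = S.graph.t d) : c = d := by
  have hcd : S.amk c = S.amk d := Quotient.sound
    ⟨by rw [ho], by rw [ht]⟩
  obtain ⟨κ, -, γ₁, -, γ₂, -, σ, h⟩ := p.exists_twist (e := S.amk d) rfl
  have h1 := (h c hcd ⟨_, p.onA_mem rfl hcd⟩ rfl).1
  have h2 := (h d rfl ⟨_, p.onA_mem rfl rfl⟩ rfl).1
  rw [ht, h2] at h1
  have h3 := σ.injective ((𝒢.Φ _).injective (γ₁.injective (Subtype.ext h1)))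
  exact ((p.bijOn_A (S.amk d)).injOn rfl hcd (congrArg Subtype.val h3)).symm

/-! ### Bijectivity of the glued map -/

namespace IsCompatible

variable {p₁ p₂ : LegalColouring S} {f : S.VT → S.VT} {φ : VS → VS}

theorem injective_quotient (h : p₁.IsCompatible p₂ f φ) (hT : S.T.IsTree) :
    Function.Injective f := by
  let F : S.T.toSimpleGraph →g S.T.toSimpleGraph := ⟨f, by
    rintro u v ⟨-, e, rfl, rfl⟩
    obtain ⟨e', ho, ht, -⟩ := h.exists_arc e
    rw [← ho, ← ht]
    exact hT.1.adj e'⟩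
  refine hT.2.connected.injective_of_locally_injective hT.2.isAcyclic F ?_
  rintro u v w ⟨-, e₁, rfl, rfl⟩ ⟨-, e₂, rfl, hv⟩ huw
  obtain ⟨e₁', ho₁, ht₁, hπ₁, hm₁, hm₁'⟩ := h.exists_arc e₁
  obtain ⟨e₂', ho₂, ht₂, hπ₂, hm₂, hm₂'⟩ := h.exists_arc e₂
  have he : e₁' = e₂' := hT.1.injective
    (Prod.ext (ho₁.trans (huw.trans ho₂.symm)) (ht₁.trans ((congrArg f hv).symm.trans ht₂.symm)))
  subst he
  have hmk₁ : ∀ c, S.amk c = e₁ → S.vmk (S.graph.t c) = S.T.t e₁ := by rintro c rfl; rfl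
  have hmk₂ : ∀ c, S.amk c = e₂ → S.vmk (S.graph.t c) = S.T.t e₁ := by rintro c rfl; exact hv
  -- Both arcs are carried onto the same arc bundle and `φ` is injective on the bundle at their
  -- common terminus. So they have the same adhesion set there, and uniqueness in condition 3
  -- applies.
  rw [p₁.eq_of_image_eq (hπ₁.symm.trans hπ₂) hv.symm]
  ext x
  constructor
  · rintro ⟨c, hc, rfl⟩
    obtain ⟨d, hd, -, hdt⟩ := hm₁ c hc
    obtain ⟨c', hc', -, hct⟩ := hm₂' d hd
    refine ⟨c', hc', congrArg p₁.onV ?_⟩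
    exact (h.compat _).injOn (hmk₂ _ hc') (hmk₁ _ hc) (hct.symm.trans hdt)
  · rintro ⟨c, hc, rfl⟩
    obtain ⟨d, hd, -, hdt⟩ := hm₂ c hc
    obtain ⟨c', hc', -, hct⟩ := hm₁' d hd
    refine ⟨c', hc', congrArg p₁.onV ?_⟩
    exact (h.compat _).injOn (hmk₁ _ hc') (hmk₂ _ hc) (hct.symm.trans hdt)

/-- The adhesion set of `e'` is pulled back through the inverse bundle map `θ`, and condition 3 for
`p₁` gives an arc `e` with that set. The image of `e` has the same adhesion set as `e'`, hence
equals it by uniqueness for `p₂`. -/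
theorem exists_arc_preimage (h : p₁.IsCompatible p₂ f φ) {q : S.VT} {e' : S.AT}
    (he' : S.T.t e' = f q) :
    ∃ e, S.T.t e = q ∧ S.T.o e' = f (S.T.o e) ∧ MapsArcBundle S φ e e' := by
  obtain ⟨θ, hθ, hφθ⟩ := (h.compat q).exists_symm
  rw [← he'] at hθ hφθ
  obtain ⟨v, hv, hv', -⟩ := id hθ
  obtain ⟨e, hπ, ht, himg⟩ := p₁.exists_arc (r := q)
    ((S.π.map_t e').symm.trans (hv.trans hv'.symm)) (p₂.isAdhesionSet_image_of_compat hθ)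
  obtain ⟨e'', ho'', ht'', hm⟩ := h.exists_arc e
  have hmk : ∀ c, S.amk c = e → S.vmk (S.graph.t c) = q := by rintro c rfl; exact ht
  have hmk' : ∀ c, S.amk c = e' → S.vmk (S.graph.t c) = S.T.t e' := by rintro c rfl; rfl
  have key : ∀ c, S.amk c = e → ∀ d, S.amk d = e' →
      p₁.onV (S.graph.t c) = p₁.onV (θ (S.graph.t d)) → φ (S.graph.t c) = S.graph.t d := by
    intro c hc d hd hcd
    rw [p₁.eq_of_onV_eq (hmk c hc) (hθ.map_vmk (hmk' d hd)) hcd, hφθ _ (hmk' d hd)]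
  have he : e'' = e' := by
    refine p₂.eq_of_image_eq (hm.1.trans hπ) (by rw [ht'', ht, he']) ?_
    ext x
    constructor
    · rintro ⟨d, hd, rfl⟩
      obtain ⟨c, hc, -, hdc⟩ := hm.2.2 d hd
      obtain ⟨d', hd', hcd⟩ := himg.subset ⟨c, hc, rfl⟩
      refine ⟨d', hd', congrArg p₂.onV ?_⟩
      rw [hdc, key c hc d' hd' hcd.symm]
    · rintro ⟨d', hd', rfl⟩
      obtain ⟨c, hc, hcd⟩ := himg.superset ⟨d', hd', rfl⟩
      obtain ⟨d, hd, -, hdc⟩ := hm.2.1 c hc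
      refine ⟨d, hd, congrArg p₂.onV ?_⟩
      rw [hdc, key c hc d' hd' hcd]
  subst he
  exact ⟨e, ht, ho'', hm⟩

theorem surjective_quotient (h : p₁.IsCompatible p₂ f φ) (hT : S.T.IsTree) :
    Function.Surjective f := by
  have := hT.2.connected.nonempty
  refine hT.2.connected.surjective_of_locally_surjective f fun v w hvw => ?_
  obtain ⟨-, e', rfl, he'⟩ := hvw.symm
  obtain ⟨e, -, ho, -⟩ := h.exists_arc_preimage he'
  exact ⟨_, ho.symm⟩

theorem bijective (h : p₁.IsCompatible p₂ f φ) (hT : S.T.IsTree) : Function.Bijective φ := by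
  constructor
  · intro w w' hw
    have h1 := (h.compat _).map_vmk (w := w) rfl
    have h2 := (h.compat _).map_vmk (w := w') rfl
    rw [hw, h2] at h1
    exact (h.compat _).injOn rfl (h.injective_quotient hT h1) hw
  · intro w
    obtain ⟨q, hq⟩ := h.surjective_quotient hT (S.vmk w)
    obtain ⟨θ, -, hθ⟩ := (h.compat q).exists_symm
    exact ⟨θ w, hθ w hq.symm⟩

end IsCompatible

/-! ### The automorphism and the conjugation -/

/-- Any two legal colourings of a scaffolding differ by a scaffolding automorphism, up to the
groups at the vertices. -/
theorem exists_autSc (hT : S.T.IsTree) (p₁ p₂ : LegalColouring S) :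
    ∃ g : S.autSc, ∀ q, Compat p₁.toColouring p₂.toColouring q (S.act g q) g.1.1 := by
  obtain ⟨f, φ, h⟩ := exists_isCompatible hT p₁ p₂
  have hφ := h.bijective hT
  have hf := h.injective_quotient hT
  have hmk : ∀ w, S.vmk (φ w) = f (S.vmk w) := fun w => (h.compat _).map_vmk rfl
  have hψ : ∀ c, ∃ d, S.graph.o d = φ (S.graph.o c) ∧ S.graph.t d = φ (S.graph.t c) ∧
      S.π.onA (S.amk d) = S.π.onA (S.amk c) := by
    intro c
    obtain ⟨e', -, -, hπ, hm, -⟩ := h.exists_arc (S.amk c)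
    obtain ⟨d, rfl, ho, ht⟩ := hm c rfl
    exact ⟨d, ho, ht, hπ⟩
  choose ψ hψo hψt hψπ using hψ
  have hψ' : Function.Bijective ψ := by
    constructor
    · intro c d hcd
      refine p₁.eq_of_o_eq_of_t_eq (hφ.1 ?_) (hφ.1 ?_)
      · rw [← hψo, ← hψo, hcd]
      · rw [← hψt, ← hψt, hcd]
    · intro d
      obtain ⟨q, hq⟩ := h.surjective_quotient hT (S.T.t (S.amk d))
      obtain ⟨e, -, -, -, -, hm⟩ := h.exists_arc_preimage hq.symm
      obtain ⟨c, -, ho, ht⟩ := hm d rfl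
      exact ⟨c, p₁.eq_of_o_eq_of_t_eq ((hψo c).trans ho.symm) ((hψt c).trans ht.symm)⟩
  have hrel : ∀ v w, S.rel v w ↔ S.rel (φ v) (φ w) := by
    intro v w
    have h1 : S.rel v w ↔ S.vmk v = S.vmk w := Quotient.eq.symm
    have h2 : S.rel (φ v) (φ w) ↔ S.vmk (φ v) = S.vmk (φ w) := Quotient.eq.symm
    rw [h1, h2, hmk, hmk, hf.eq_iff]
  have hπ : ∀ v, S.π.onV (S.vmk (φ v)) = S.π.onV (S.vmk v) := by
    intro v
    obtain ⟨u, h1, h2, -⟩ := h.compat (S.vmk v)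
    rw [hmk, h1, h2]
  refine ⟨⟨(Equiv.ofBijective φ hφ, Equiv.ofBijective ψ hψ'),
    ⟨fun c => (hψo c).symm, fun c => (hψt c).symm, fun c => ?_⟩, hrel, hπ, hψπ⟩, fun q => ?_⟩
  -- Compatibility with reversal need not be built into `ψ`: comparing end points suffices.
  · refine p₁.eq_of_o_eq_of_t_eq ?_ ?_
    · exact (hψo _).trans (by rw [← S.graph.t_eq, ← hψt, S.graph.t_eq]; rfl)
    · exact (hψt _).trans (by rw [← S.graph.o_eq, ← hψo, S.graph.o_eq]; rfl)
  · induction q using Quotient.inductionOn with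
    | h w =>
      have := h.compat (S.vmk w)
      rwa [← hmk] at this

end LegalColouring

theorem mainTheorem3 {V A α β VS AS : Type*} (𝒢 : GraphOfGroupActions V A α β)
    (S : Scaffolding 𝒢 VS AS) (p : LegalColouring S.toScaffoldingFrame)
    (H : Subgroup S.autSc) (hH : IsLocally 𝒢 H) :
    ∃ K : Subgroup S.autSc, K ≤ universalGroup p ∧
      ∃ φ : S.autSc, H.map (MulAut.conj φ).toMonoidHom = K := by
  obtain ⟨p', hp'⟩ := hH
  obtain ⟨φ, hφ⟩ := LegalColouring.exists_autSc S.isTree p' p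
  refine ⟨_, ?_, φ, rfl⟩
  rintro _ ⟨h, hh, rfl⟩ q
  rw [← Colouring.compat_act_iff]
  have h1 := (hφ (S.act φ⁻¹ q)).symm
  rw [← S.act_mul, mul_inv_cancel, S.act_one] at h1
  have h2 := (p'.toColouring.compat_act_iff h (S.act φ⁻¹ q)).2 (hp' h hh _)
  -- The colourings change along the composite as `p` to `p'` by `φ⁻¹`, `p'` to `p'` by `h`, and
  -- `p'` to `p` by `φ`.
  have h3 := ((hφ _).comp h2).comp h1
  rw [← S.act_mul, ← S.act_mul] at h3
  exact h3
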